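/- Let $K$ be a totally real number field of degree $n$ with ring of integers $\mathcal O_K$, discriminant $\mathrm{disc}_K$ and real embeddings $\sigma_1,\dots,\sigma_n : K\to\mathbb R$. Let $L\ge 1$ be an integer, $P>0$, and $\mathbf h_1,\dots,\mathbf h_n\in\mathbb R^L$ (the channel vectors of the $n$ fading blocks). Write $\log$ for the logarithm to base $2$, $\log^+ x=\max(\log x,0)$, and $\|\cdot\|$ for the Euclidean norm. For $m\ge1$ let $$\kappa_m=\sup_{\Lambda}\ \lambda_1(\Lambda)^2/\det(\Lambda)^{2/m}$$ be Hermite's constant, where $\Lambda$ ranges over the full-rank lattices in $\mathbb R^m$, $\lambda_1(\Lambda)$ is the length of a shortest nonzero vector and $\det(\Lambda)$ is the covolume. Put $\mathbf M_j=\mathbf I-\frac{P}{P\|\mathbf h_j\|^2+1}\mathbf h_j\mathbf h_j^{\top}$ and write $\mathbf M_j=\bar{\mathbf M}_j^{\top}\bar{\mathbf M}_j$ with $\bar{\mathbf M}_j\in\mathbb R^{L\times L}$ (such as the Cholesky decomposition). For $\mathbf a\in\mathcal O_K^L$ let $\sigma_j(\mathbf a)\in\mathbb R^L$ be the vector obtained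 by applying $\sigma_j$ entrywise, and let $$F(\mathbf a)=\sum_{j=1}^n\sigma_j(\mathbf a)^{\top}\mathbf M_j\,\sigma_j(\mathbf a)=\sum_{j=1}^n\|\bar{\mathbf M}_j\sigma_j(\mathbf a)\|^2 .$$ For $1\le i\le L$ define the $i$-th $\mathcal O_K$-successive minimum of the module $\Lambda^{\mathcal O_K}(\{\bar{\mathbf M}_j\})$, that is, of $\mathcal O_K^L$ embedded in $\mathbb R^{nL}$ by $\mathbf a\mapsto(\bar{\mathbf M}_j\sigma_j(\mathbf a))_{j}$, as $$\lambda_i=\inf\Bigl\{r:\ \dim_K\mathrm{span}_K\{\mathbf a\in\mathcal O_K^L:\ F(\mathbf a)^{1/2}\le r\}\ge i\Bigr\}.$$ There exist vectors $\mathbf a_1,\dots,\mathbf a_L\in\mathcal O_K^L$, linearly independent over $\mathcal O_K$, with $F(\mathbf a_i)=\lambda_i^2$ for $i=1,\dots,L$. For every such choice, the rates $$R_{\mathrm{achv},i}=\frac n2\log^+\!\Bigl(\frac{n}{F(\mathbf a_i)}\Bigr),\qquad i=1,\dots,L,$$ satisfy $$R_{\mathrm{achv},1}\ \ge\ \frac1{2L}\sum_{j=1}^n\log^+\bigl(1+P\|\mathbf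 h_j\|^2\bigr)-\frac n2\log^+\!\Bigl(\frac{\kappa_{nL}}{n}\,\mathrm{disc}_K^{1/n}\Bigr)$$ and $$\sum_{i=1}^L R_{\mathrm{achv},i}\ \ge\ \frac12\sum_{j=1}^n\log^+\bigl(1+P\|\mathbf h_j\|^2\bigr)-\frac{nL}2\log^+\!\Bigl(\frac{\kappa_{nL}}{n}\,\mathrm{disc}_K^{1/n}\Bigr).$$ -/

import Mathlib

open scoped Matrix NumberField

namespace RingCF

noncomputable section

/-- `log⁺ x = max (log x) 0`, with logarithm to base `2`. -/
def logPlus (x : ℝ) : ℝ := max (Real.logb 2 x) 0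

/-- The `ℤ`-lattice in `ℝ^m` generated by the columns of `D`. -/
def latticeOf {m : ℕ} (D : Matrix (Fin m) (Fin m) ℝ) :
    Submodule ℤ (EuclideanSpace ℝ (Fin m)) :=
  Submodule.span ℤ (Set.range fun k : Fin m => WithLp.toLp 2 (fun i => D i k))

/-- The first minimum `λ₁` of a lattice: the minimal Euclidean length of a nonzero vector. -/
def firstMinimum {m : ℕ} (Λ : Submodule ℤ (EuclideanSpace ℝ (Fin m))) : ℝ :=
  sInf {r : ℝ | ∃ x ∈ Λ, x ≠ 0 ∧ ‖x‖ = r}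

/-- Hermite's constant `κ_m`: the supremum of `λ₁(Λ(D))² / |det D|^(2/m)` over all lattices of
full rank in `ℝ^m`. -/
def hermiteConstant (m : ℕ) : ℝ :=
  sSup {c : ℝ | ∃ D : Matrix (Fin m) (Fin m) ℝ, D.det ≠ 0 ∧
    c = firstMinimum (latticeOf D) ^ 2 / |D.det| ^ (2 / (m : ℝ))}

/-- The matrix `I - P / (P ‖h‖² + 1) • h hᵀ`. -/
def channelMatrix {L : ℕ} (P : ℝ) (h : EuclideanSpace ℝ (Fin L)) :
    Matrix (Fin L) (Fin L) ℝ :=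
  1 - (P / (P * ‖h‖ ^ 2 + 1)) • Matrix.vecMulVec h h

/-- A generator tuple `M̄ⱼ`, i.e. a factorization `Mⱼ = M̄ⱼᵀ M̄ⱼ` for every block `j`
(for instance the Cholesky one). -/
def IsGenerator {n L : ℕ} (P : ℝ) (h : Fin n → EuclideanSpace ℝ (Fin L))
    (Mbar : Fin n → Matrix (Fin L) (Fin L) ℝ) : Prop :=
  ∀ j, (Mbar j)ᵀ * Mbar j = channelMatrix P (h j)

/-- Generator tuples always exist. -/
theorem exists_isGenerator {n L : ℕ} {P : ℝ} (hP : 0 ≤ P)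
    (h : Fin n → EuclideanSpace ℝ (Fin L)) : ∃ Mbar, IsGenerator P h Mbar := by
  have key : ∀ v : EuclideanSpace ℝ (Fin L),
      ∃ B : Matrix (Fin L) (Fin L) ℝ, Bᵀ * B = channelMatrix P v := by
    intro v
    have hs : (0 : ℝ) ≤ ‖v‖ ^ 2 := by positivity
    have hdot : dotProduct (v : Fin L → ℝ) v = ‖v‖ ^ 2 := by
      rw [EuclideanSpace.real_norm_sq_eq]
      simp [dotProduct, pow_two]
    have hq : 0 < P * ‖v‖ ^ 2 + 1 := by positivity
    set s := ‖v‖ ^ 2 with hsdef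
    set c := P / (P * s + 1) with hc
    set u := Real.sqrt (1 / (P * s + 1)) with hu
    have hu0 : 0 ≤ u := Real.sqrt_nonneg _
    have hu2 : u ^ 2 = 1 - c * s := by
      rw [hu, Real.sq_sqrt (by positivity), hc]
      field_simp
      ring
    refine ⟨1 - (c / (1 + u)) • Matrix.vecMulVec v v, ?_⟩
    have hd : 2 * (c / (1 + u)) - (c / (1 + u)) ^ 2 * s = c := by
      have h1 : (1 + u) ≠ 0 := by positivity
      field_simp
      linear_combination (-c) * hu2
    have hT : (Matrix.vecMulVec (v : Fin L → ℝ) v)ᵀ = Matrix.vecMulVec v v := by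
      ext i k; simp [Matrix.vecMulVec_apply, mul_comm]
    have hW : Matrix.vecMulVec (v : Fin L → ℝ) v * Matrix.vecMulVec v v
        = s • Matrix.vecMulVec (v : Fin L → ℝ) v := by
      rw [Matrix.vecMulVec_mul_vecMulVec, hdot]
      ext i k; simp [Matrix.vecMulVec_apply]; ring
    simp only [Matrix.transpose_sub, Matrix.transpose_one, Matrix.transpose_smul, hT, sub_mul,
      mul_sub, one_mul, mul_one, smul_mul_assoc, mul_smul_comm, hW, channelMatrix]
    ext i k
    simp only [Matrix.sub_apply, Matrix.smul_apply, smul_eq_mul]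
    linear_combination (-Matrix.vecMulVec (v : Fin L → ℝ) v i k) * hd
  choose B hB using key
  exact ⟨fun j => B (h j), fun j => hB (h j)⟩

variable {K : Type*} [Field K] [NumberField K] {n L : ℕ}

/-- The vector `σⱼ(a)` obtained by applying the `j`-th embedding to every entry of `a`. -/
def conj (σ : Fin n ≃ (K →+* ℝ)) (j : Fin n) (a : Fin L → 𝓞 K) : Fin L → ℝ :=
  fun l => σ j (a l : K)

/-- The additive Humbert form `F(a) = ∑ⱼ σⱼ(a)ᵀ Mⱼ σⱼ(a)`. -/
def humbertForm (σ : Fin n ≃ (K →+* ℝ)) (P : ℝ) (h : Fin n → EuclideanSpace ℝ (Fin L))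
    (a : Fin L → 𝓞 K) : ℝ :=
  ∑ j, conj σ j a ⬝ᵥ (channelMatrix P (h j) *ᵥ conj σ j a)

/-- The embedding into `ℝ^(nL)` of the element with coefficient vector `a` of the
`𝓞 K`-module generated by the tuple `M̄ⱼ`: the concatenation of the vectors `M̄ⱼ σⱼ(a)`. -/
def moduleEmbedding (σ : Fin n ≃ (K →+* ℝ)) (Mbar : Fin n → Matrix (Fin L) (Fin L) ℝ)
    (a : Fin L → 𝓞 K) : EuclideanSpace ℝ (Fin n × Fin L) :=
  WithLp.toLp 2 fun p => (Mbar p.1 *ᵥ conj σ p.1 a) p.2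

/-- The `i`-th successive minimum (`1 ≤ i ≤ L`) over `𝓞 K` of the module generated by the tuple
`M̄ⱼ`: the infimum of the `r` such that the elements of embedded length at most `r` span a
`K`-space of dimension at least `i`. -/
def successiveMinimum (σ : Fin n ≃ (K →+* ℝ)) (Mbar : Fin n → Matrix (Fin L) (Fin L) ℝ)
    (i : ℕ) : ℝ :=
  sInf {r : ℝ | i ≤ Module.finrank K (Submodule.span K
    ((fun (a : Fin L → 𝓞 K) (l : Fin L) => (a l : K)) ''
      {a : Fin L → 𝓞 K | ‖moduleEmbedding σ Mbar a‖ ≤ r}))}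

/-- `a 0, …, a (L - 1)` are coefficient vectors of the `L` successive minima over `𝓞 K`. -/
def AchievesMinima (σ : Fin n ≃ (K →+* ℝ)) (Mbar : Fin n → Matrix (Fin L) (Fin L) ℝ)
    (a : Fin L → Fin L → 𝓞 K) : Prop :=
  LinearIndependent (𝓞 K) a ∧
    ∀ i : Fin L, ‖moduleEmbedding σ Mbar (a i)‖ = successiveMinimum σ Mbar (i + 1)

/-- The equation rate `(n / 2) log⁺ (n / F(a))` of a coefficient vector `a`. -/
def equationRate (σ : Fin n ≃ (K →+* ℝ)) (P : ℝ) (h : Fin n → EuclideanSpace ℝ (Fin L))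
    (a : Fin L → 𝓞 K) : ℝ :=
  (n : ℝ) / 2 * logPlus ((n : ℝ) / humbertForm σ P h a)

end

end RingCF

open scoped Matrix NumberField

namespace RingCF

/-! Since `F(a)` is the squared length of the embedded vector, the module is a lattice of rank `nL`
in `ℝ^(nL)`. Its covolume is `|disc|^(L/2) ∏ⱼ |det M̄ⱼ|`, where `det M̄ⱼ² = 1/(1 + P‖hⱼ‖²)` by the
determinant of a rank-one perturbation. Hermite's inequality (`sq_le_hermiteConstant_mul_discr`)
bounds the shortest vector, and taking logarithms gives the first rate bound.

The sum bound needs the same estimate for the geometric mean of the `λᵢ²`. As in Minkowski's second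
theorem, each block is rotated to the Gram–Schmidt basis of the images of the `aᵢ` and its `i`-th
coordinate is divided by `λᵢ`. A nonzero vector in the span of `a₀, …, aᵢ` of length at least `λᵢ`
has no coordinates beyond `i`, so after the distortion it still has length at least `1`. Hermite's
inequality for the distorted lattice, whose covolume carries the factor `(∏ λᵢ)⁻ⁿ`, is the claim
(`AchievesMinima.one_le_hermiteConstant_mul`).

Minimal vectors exist by a greedy choice, because only finitely many module elements have bounded
length. -/

/-! ### Hermite's constant and its finiteness -/

open MeasureTheory in
/-- Minkowski's bound for the first minimum of a lattice, up to a constant depending on the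
dimension only. -/
theorem exists_firstMinimum_le {m : ℕ} (hm : 0 < m) :
    ∃ C : ℝ, 0 ≤ C ∧ ∀ D : Matrix (Fin m) (Fin m) ℝ, D.det ≠ 0 →
      firstMinimum (latticeOf D) ≤ C * |D.det| ^ (1 / (m : ℝ)) := by
  have : Nonempty (Fin m) := ⟨⟨0, hm⟩⟩
  have : Nontrivial (EuclideanSpace ℝ (Fin m)) :=
    ⟨⟨0, EuclideanSpace.single ⟨0, hm⟩ 1, fun h => by
      simpa using congrArg (fun v : EuclideanSpace ℝ (Fin m) => v ⟨0, hm⟩) h⟩⟩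
  have hm' : (m : ℝ) ≠ 0 := by positivity
  set b₀ := (EuclideanSpace.basisFun (Fin m) ℝ).toBasis with hb₀
  set V := volume (ZSpan.fundamentalDomain b₀) with hV
  set B := volume (Metric.ball (0 : EuclideanSpace ℝ (Fin m)) 1) with hB
  have hV0 : V ≠ 0 := ZSpan.measure_fundamentalDomain_ne_zero b₀
  have hVt : V ≠ ⊤ := (ZSpan.fundamentalDomain_isBounded b₀).measure_lt_top.ne
  have hB0 : B ≠ 0 := (Metric.measure_ball_pos _ _ one_pos).ne'
  have hBt : B ≠ ⊤ := measure_ball_lt_top.ne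
  have hv : 0 < V.toReal := ENNReal.toReal_pos hV0 hVt
  have hw : 0 < B.toReal := ENNReal.toReal_pos hB0 hBt
  -- The inner factor `2` makes the ball of radius `r` have volume twice `2^m` times the covolume,
  -- so that the strict inequality in Minkowski's theorem holds.
  refine ⟨2 * (2 * V.toReal / B.toReal) ^ (1 / (m : ℝ)), by positivity, fun D hD => ?_⟩
  set r := 2 * (2 * V.toReal / B.toReal) ^ (1 / (m : ℝ)) * |D.det| ^ (1 / (m : ℝ)) with hr
  have hd : 0 < |D.det| := abs_pos.mpr hD
  have hr0 : 0 ≤ r := by positivity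
  have hrm : r ^ m = 2 ^ m * (2 * V.toReal / B.toReal) * |D.det| := by
    rw [hr, mul_pow, mul_pow, ← Real.rpow_natCast (_ ^ (1 / (m : ℝ))) m,
      ← Real.rpow_natCast (|D.det| ^ (1 / (m : ℝ))) m, ← Real.rpow_mul (by positivity),
      ← Real.rpow_mul (by positivity), one_div_mul_cancel hm', Real.rpow_one, Real.rpow_one]
  set v : Fin m → EuclideanSpace ℝ (Fin m) := fun k => WithLp.toLp 2 (fun i => D i k) with hvdef
  have hmat : b₀.toMatrix v = D := by
    ext i k
    simp [Module.Basis.toMatrix_apply, hb₀, hvdef]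
  have hdet : b₀.det v = D.det := by rw [Module.Basis.det_apply, hmat]
  obtain ⟨hli, hsp⟩ := (Module.Basis.is_basis_iff_det b₀ (v := v)).mpr
    (by rw [hdet]; exact isUnit_iff_ne_zero.mpr hD)
  set b := Module.Basis.mk hli hsp.ge with hb
  have hbv : ⇑b = v := Module.Basis.coe_mk _ _
  have hfund : volume (ZSpan.fundamentalDomain b) = ENNReal.ofReal |D.det| * V := by
    rw [ZSpan.measure_fundamentalDomain b volume b₀, hbv, hdet]
  have hlt : volume (ZSpan.fundamentalDomain b)
      * 2 ^ Module.finrank ℝ (EuclideanSpace ℝ (Fin m))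
        < volume (Metric.ball (0 : EuclideanSpace ℝ (Fin m)) r) := by
    rw [hfund, Measure.addHaar_ball _ _ hr0, finrank_euclideanSpace_fin, ← hB,
      ← ENNReal.ofReal_toReal hVt, ← ENNReal.ofReal_toReal hBt,
      ← ENNReal.ofReal_mul (by positivity), ← ENNReal.ofReal_mul (by positivity),
      show (2 : ENNReal) = ENNReal.ofReal 2 by simp, ← ENNReal.ofReal_pow (by positivity),
      ← ENNReal.ofReal_mul (by positivity), ENNReal.ofReal_lt_ofReal_iff_of_nonneg (by positivity),
      hrm]
    have : 2 ^ m * (2 * V.toReal / B.toReal) * |D.det| * B.toReal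
        = 2 * (|D.det| * V.toReal * 2 ^ m) := by
      field_simp
    rw [this]
    have : 0 < |D.det| * V.toReal * 2 ^ m := by positivity
    linarith
  have : Countable (Submodule.span ℤ (Set.range b)).toAddSubgroup :=
    inferInstanceAs (Countable (Submodule.span ℤ (Set.range b)))
  obtain ⟨x, hx0, hx⟩ := exists_ne_zero_mem_lattice_of_measure_mul_two_pow_lt_measure
    (ZSpan.isAddFundamentalDomain' b volume) (s := Metric.ball 0 r)
    (fun y hy => by simpa using hy) (convex_ball _ _) hlt
  have hxr : ‖(x : EuclideanSpace ℝ (Fin m))‖ < r := by simpa using hx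
  refine le_trans (csInf_le ⟨0, ?_⟩ ⟨x, ?_, fun h => hx0 (Subtype.ext h), rfl⟩) hxr.le
  · rintro _ ⟨y, _, _, rfl⟩
    exact norm_nonneg y
  · have hlat : Submodule.span ℤ (Set.range b) = latticeOf D := by rw [hbv]; rfl
    exact hlat.le x.2

theorem firstMinimum_nonneg {m : ℕ} (Λ : Submodule ℤ (EuclideanSpace ℝ (Fin m))) :
    0 ≤ firstMinimum Λ :=
  Real.sInf_nonneg (by rintro _ ⟨y, _, _, rfl⟩; exact norm_nonneg y)

/-- The set whose supremum is Hermite's constant is bounded. -/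
theorem bddAbove_hermite {m : ℕ} (hm : 0 < m) :
    BddAbove {c : ℝ | ∃ D : Matrix (Fin m) (Fin m) ℝ, D.det ≠ 0 ∧
      c = firstMinimum (latticeOf D) ^ 2 / |D.det| ^ (2 / (m : ℝ))} := by
  obtain ⟨C, hC, h⟩ := exists_firstMinimum_le hm
  refine ⟨C ^ 2, ?_⟩
  rintro _ ⟨D, hD, rfl⟩
  have hd : 0 < |D.det| := abs_pos.mpr hD
  rw [div_le_iff₀ (by positivity)]
  calc firstMinimum (latticeOf D) ^ 2 ≤ (C * |D.det| ^ (1 / (m : ℝ))) ^ 2 :=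
        pow_le_pow_left₀ (firstMinimum_nonneg _) (h D hD) 2
    _ = C ^ 2 * |D.det| ^ (2 / (m : ℝ)) := by
        rw [mul_pow, ← Real.rpow_natCast (_ ^ (1 / (m : ℝ))) 2, ← Real.rpow_mul hd.le]
        congr 2
        push_cast
        ring

/-- A lower bound for the norms of the nonzero vectors of a lattice is controlled by Hermite's
constant and the determinant. -/
theorem sq_le_hermiteConstant_mul {m : ℕ} (hm : 0 < m) (D : Matrix (Fin m) (Fin m) ℝ)
    (hD : D.det ≠ 0) {c : ℝ} (hc : 0 ≤ c) (h : ∀ x ∈ latticeOf D, x ≠ 0 → c ≤ ‖x‖) :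
    c ^ 2 ≤ hermiteConstant m * |D.det| ^ (2 / (m : ℝ)) := by
  have hd : 0 < |D.det| := abs_pos.mpr hD
  have hle : c ≤ firstMinimum (latticeOf D) := by
    -- The infimum needs a nonempty set; a column of `D` is a nonzero lattice vector because `det D
    -- ≠ 0`.
    refine le_csInf ⟨_, WithLp.toLp 2 (fun i => D i ⟨0, hm⟩), Submodule.subset_span ⟨⟨0, hm⟩, rfl⟩,
      fun h0 => hD (Matrix.det_eq_zero_of_column_eq_zero ⟨0, hm⟩ fun i => ?_), rfl⟩ ?_
    · simpa using congrArg (fun v : EuclideanSpace ℝ (Fin m) => v i) h0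
    · rintro _ ⟨x, hx, hx0, rfl⟩
      exact h x hx hx0
  calc c ^ 2 ≤ firstMinimum (latticeOf D) ^ 2 := pow_le_pow_left₀ hc hle 2
    _ ≤ _ := by
      rw [← div_le_iff₀ (by positivity)]
      -- The real `sSup` dominates the members of its set only when the set is bounded; this is
      -- where Minkowski's bound enters.
      exact le_csSup (bddAbove_hermite hm) ⟨D, hD, rfl⟩

/-! ### Successive minima of an abstract length function -/

section AbstractMinima

variable {F V X : Type*} [Field F] [AddCommGroup V] [Module F V] (ι : X → V) (ν : X → ℝ)

/-- Successive minima of a length function `ν` with respect to a map `ι` to a vector space. -/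
noncomputable def lengthMinimum (F : Type*) {V X : Type*} [Field F] [AddCommGroup V] [Module F V]
    (ι : X → V) (ν : X → ℝ) (i : ℕ) : ℝ :=
  sInf {r : ℝ | i ≤ Module.finrank F (Submodule.span F (ι '' {x | ν x ≤ r}))}

variable {ι ν}

/-- A negative radius has an empty sublevel set, whose span has dimension `0 < i`. Hence the
admissible radii are bounded below and the infimum is genuine; for `i = 0` every real number would
be admissible. -/
theorem lengthMinimum_le (hν : ∀ x, 0 ≤ ν x) {i : ℕ} (hi : 0 < i) {r : ℝ}
    (hr : i ≤ Module.finrank F (Submodule.span F (ι '' {x | ν x ≤ r}))) :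
    lengthMinimum F ι ν i ≤ r := by
  refine csInf_le ⟨0, fun s hs => ?_⟩ hr
  by_contra! hneg
  have hempty : {x | ν x ≤ s} = ∅ := by
    ext x
    simpa using hneg.trans_le (hν x)
  rw [Set.mem_ofPred_eq, hempty, Set.image_empty, Submodule.span_empty, finrank_bot] at hs
  omega

/-- An element shorter than the `i`-th minimum lies in the span of vectors achieving the
previous minima. -/
theorem mem_span_of_lt_lengthMinimum [Module.Finite F V] (hν : ∀ x, 0 ≤ ν x) {L : ℕ}
    {a : Fin L → X} (ha : LinearIndependent F (ι ∘ a))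
    (hle : ∀ i : Fin L, ν (a i) ≤ lengthMinimum F ι ν (i + 1)) (i : Fin L) {x : X}
    (hx : ν x < lengthMinimum F ι ν (i + 1)) :
    ι x ∈ Submodule.span F ((ι ∘ a) '' Set.Iio i) := by
  -- `U` has dimension `d ≤ i` because `x` is below the minimum of index `i + 1`. The first `d` of
  -- the `a k` lie in `U`, since `ν x` is at least their minima, and being independent they span it.
  set U := Submodule.span F (ι '' {y | ν y ≤ ν x}) with hU
  set d := Module.finrank F U with hd
  have hdi : d ≤ i := by
    by_contra! hlt
    exact hx.not_ge (lengthMinimum_le hν (Nat.succ_pos _) hlt)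
  have hdL : d ≤ L := hdi.trans i.2.le
  have hb : LinearIndependent F ((ι ∘ a) ∘ Fin.castLE hdL) := ha.comp _ (Fin.castLE_injective hdL)
  have hsub : Submodule.span F (Set.range ((ι ∘ a) ∘ Fin.castLE hdL)) ≤ U := by
    rw [Submodule.span_le]
    rintro _ ⟨k, rfl⟩
    refine Submodule.subset_span ⟨_, (hle _).trans (lengthMinimum_le hν (Nat.succ_pos _) ?_), rfl⟩
    exact k.2
  have heq := Submodule.eq_of_le_of_finrank_eq hsub (by
    rw [finrank_span_eq_card hb, Fintype.card_fin])
  have hxU : ι x ∈ U := Submodule.subset_span ⟨x, le_refl (ν x), rfl⟩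
  rw [← heq] at hxU
  refine Submodule.span_mono ?_ hxU
  rintro _ ⟨k, rfl⟩
  exact ⟨Fin.castLE hdL k, Fin.lt_def.mpr (k.2.trans_le hdi), rfl⟩

/-- The sequence obtained by applying a choice function to the span of the previous terms. -/
def greedySeq (ι : X → V) (f : Submodule F V → X) (i : ℕ) : X :=
  f (Submodule.span F (Set.range fun k : Fin i => ι (greedySeq ι f k)))
termination_by i
decreasing_by exact k.2

/-- Successive minima of a length function with finite sublevel sets are achieved. -/
theorem exists_achieves_lengthMinimum [Module.Finite F V] [Nonempty X] (hν : ∀ x, 0 ≤ ν x)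
    (hfin : ∀ r, {x | ν x ≤ r}.Finite) (hspan : Submodule.span F (Set.range ι) = ⊤) {L : ℕ}
    (hL : Module.finrank F V = L) :
    ∃ a : Fin L → X, LinearIndependent F (ι ∘ a) ∧
      ∀ i : Fin L, ν (a i) = lengthMinimum F ι ν (i + 1) := by
  -- The greedy choice: a shortest `x` outside `W`. Searching only among lengths at most `ν x₀`
  -- leaves a finite set.
  have hstep : ∀ W : Submodule F V, ∃ x : X, W ≠ ⊤ → ι x ∉ W ∧ ∀ y, ι y ∉ W → ν x ≤ ν y := by
    intro W
    by_cases hW : W = ⊤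
    · exact ⟨Classical.arbitrary X, fun h => (h hW).elim⟩
    · have hex : ∃ x, ι x ∉ W := by
        by_contra! hall
        refine hW (top_le_iff.mp (hspan.ge.trans (Submodule.span_le.mpr ?_)))
        rintro _ ⟨x, rfl⟩
        exact hall x
      obtain ⟨x₀, hx₀⟩ := hex
      obtain ⟨x, ⟨hx, hxle⟩, hmin⟩ := Set.exists_min_image
        ({x | ι x ∉ W} ∩ {x | ν x ≤ ν x₀}) ν ((hfin _).inter_of_right _) ⟨x₀, hx₀, le_refl (ν x₀)⟩
      refine ⟨x, fun _ => ⟨hx, fun y hy => ?_⟩⟩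
      rcases le_total (ν y) (ν x₀) with h | h
      · exact hmin y ⟨hy, h⟩
      · exact le_trans hxle h
  choose f hf using hstep
  set s : ℕ → X := greedySeq ι f with hs
  let W : ℕ → Submodule F V := fun i => Submodule.span F (Set.range fun k : Fin i => ι (s k))
  have hsW : ∀ i, s i = f (W i) := fun i => by rw [hs, greedySeq]
  have hWdim : ∀ i, Module.finrank F (W i) ≤ i := fun i => by
    simpa only [Fintype.card_fin] using! finrank_range_le_card (R := F) (fun k : Fin i => ι (s k))
  have hW : ∀ i < L, W i ≠ ⊤ := fun i hi htop => by
    have := hWdim i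
    rw [htop, finrank_top, hL] at this
    omega
  have hnot : ∀ i < L, ι (s i) ∉ W i := fun i hi => hsW i ▸ (hf _ (hW i hi)).1
  have hmin : ∀ i < L, ∀ y, ι y ∉ W i → ν (s i) ≤ ν y := fun i hi => hsW i ▸ (hf _ (hW i hi)).2
  have hWmono : Monotone W := fun i j hij => Submodule.span_mono (by
    rintro _ ⟨k, rfl⟩
    exact ⟨Fin.castLE hij k, rfl⟩)
  have hsmono : ∀ i < L, ∀ k ≤ i, ν (s k) ≤ ν (s i) := fun i hi k hk =>
    hmin k (hk.trans_lt hi) _ fun hmem => hnot i hi (hWmono hk hmem)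
  have hli : ∀ k ≤ L, LinearIndependent F fun i : Fin k => ι (s i) := by
    intro k
    induction k with
    | zero => exact fun _ => linearIndependent_empty_type
    | succ k ih =>
      intro hk
      rw [linearIndependent_finSucc']
      exact ⟨ih (by omega), hnot k hk⟩
  have hdim : ∀ i < L,
      i + 1 ≤ Module.finrank F (Submodule.span F (ι '' {x | ν x ≤ ν (s i)})) := by
    intro i hi
    rw [← Fintype.card_fin (i + 1), ← finrank_span_eq_card (hli (i + 1) hi)]
    refine Submodule.finrank_mono (Submodule.span_mono ?_)
    rintro _ ⟨k, rfl⟩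
    exact ⟨s k, hsmono i hi k (Nat.lt_succ_iff.mp k.2), rfl⟩
  refine ⟨fun i => s i, hli L le_rfl, fun i => le_antisymm ?_ ?_⟩
  -- For `r < ν (s i)`, minimality of `s i` outside `W i` puts everything of length at most `r`
  -- inside `W i`, whose dimension `≤ i` is one too small.
  · refine le_csInf ⟨ν (s i), hdim i i.2⟩ fun r hr => ?_
    by_contra! hlt
    have hle : Submodule.span F (ι '' {x | ν x ≤ r}) ≤ W i := by
      rw [Submodule.span_le]
      rintro _ ⟨y, hy, rfl⟩
      by_contra hyW
      exact (hlt.trans_le (hmin i i.2 y hyW)).not_ge hy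
    have := (Submodule.finrank_mono hle).trans (hWdim i)
    simp only [Set.mem_ofPred_eq] at hr
    omega
  · exact lengthMinimum_le hν (Nat.succ_pos _) (hdim i i.2)

end AbstractMinima

/-! ### The embedding of the module and its length -/

variable {K : Type*} [Field K] {n L : ℕ}

theorem conj_add (σ : Fin n ≃ (K →+* ℝ)) (j : Fin n) (a b : Fin L → 𝓞 K) :
    conj σ j (a + b) = conj σ j a + conj σ j b := by
  ext l; simp [conj]

theorem conj_zsmul (σ : Fin n ≃ (K →+* ℝ)) (j : Fin n) (z : ℤ) (a : Fin L → 𝓞 K) :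
    conj σ j (z • a) = z • conj σ j a := by
  ext l; simp [conj]

theorem moduleEmbedding_add (σ : Fin n ≃ (K →+* ℝ)) (N : Fin n → Matrix (Fin L) (Fin L) ℝ)
    (a b : Fin L → 𝓞 K) :
    moduleEmbedding σ N (a + b) = moduleEmbedding σ N a + moduleEmbedding σ N b := by
  ext p; simp [moduleEmbedding, conj_add, Matrix.mulVec_add]

theorem moduleEmbedding_zsmul (σ : Fin n ≃ (K →+* ℝ)) (N : Fin n → Matrix (Fin L) (Fin L) ℝ)
    (z : ℤ) (a : Fin L → 𝓞 K) :
    moduleEmbedding σ N (z • a) = z • moduleEmbedding σ N a := by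
  ext p
  simp only [moduleEmbedding, conj_zsmul, Matrix.mulVec_smul]
  simp

theorem moduleEmbedding_zero (σ : Fin n ≃ (K →+* ℝ)) (N : Fin n → Matrix (Fin L) (Fin L) ℝ) :
    moduleEmbedding σ N (0 : Fin L → 𝓞 K) = 0 := by
  simpa using moduleEmbedding_zsmul σ N 0 0

theorem dotProduct_self_eq_norm_sq (v : EuclideanSpace ℝ (Fin L)) :
    (v : Fin L → ℝ) ⬝ᵥ v = ‖v‖ ^ 2 := by
  rw [EuclideanSpace.real_norm_sq_eq]
  simp [dotProduct, pow_two]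

/-- The squared norm of the embedded vector, block by block. -/
theorem norm_moduleEmbedding_sq (σ : Fin n ≃ (K →+* ℝ)) (N : Fin n → Matrix (Fin L) (Fin L) ℝ)
    (a : Fin L → 𝓞 K) :
    ‖moduleEmbedding σ N a‖ ^ 2
      = ∑ j, ‖(WithLp.toLp 2 (N j *ᵥ conj σ j a) : EuclideanSpace ℝ (Fin L))‖ ^ 2 := by
  simp only [EuclideanSpace.real_norm_sq_eq, Fintype.sum_prod_type, moduleEmbedding]

theorem IsGenerator.norm_sq {P : ℝ} {h : Fin n → EuclideanSpace ℝ (Fin L)}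
    {Mbar : Fin n → Matrix (Fin L) (Fin L) ℝ} (hM : IsGenerator P h Mbar)
    (σ : Fin n ≃ (K →+* ℝ)) (a : Fin L → 𝓞 K) :
    ‖moduleEmbedding σ Mbar a‖ ^ 2 = humbertForm σ P h a := by
  rw [norm_moduleEmbedding_sq, humbertForm]
  refine Finset.sum_congr rfl fun j _ => ?_
  rw [← hM j, ← Matrix.mulVec_mulVec, Matrix.dotProduct_mulVec, Matrix.vecMul_transpose,
    ← dotProduct_self_eq_norm_sq]

/-- Nonzero coefficient vectors have nonzero embedding. -/
theorem moduleEmbedding_ne_zero (hn0 : 0 < n) (σ : Fin n ≃ (K →+* ℝ))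
    {N : Fin n → Matrix (Fin L) (Fin L) ℝ} (hN : ∀ j, (N j).det ≠ 0)
    {a : Fin L → 𝓞 K} (ha : a ≠ 0) : moduleEmbedding σ N a ≠ 0 := by
  intro h0
  apply ha
  -- One block suffices: `N 0` is invertible and `σ 0` is injective.
  have h1 : N ⟨0, hn0⟩ *ᵥ conj σ ⟨0, hn0⟩ a = 0 := by
    ext l
    simpa [moduleEmbedding] using
      congrArg (fun v : EuclideanSpace ℝ (Fin n × Fin L) => v (⟨0, hn0⟩, l)) h0
  have h2 := Matrix.eq_zero_of_mulVec_eq_zero (hN _) h1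
  ext l
  simpa [conj] using congrFun h2 l

theorem logb_le_logPlus (x : ℝ) : Real.logb 2 x ≤ logPlus x := le_max_left _ _

/-- Truncation only raises the rate, so both bounds can be proved for the plain logarithm, which is
affine in the logarithm of the length. -/
theorem IsGenerator.le_equationRate {P : ℝ} {h : Fin n → EuclideanSpace ℝ (Fin L)}
    {Mbar : Fin n → Matrix (Fin L) (Fin L) ℝ} (hM : IsGenerator P h Mbar) (hn0 : 0 < n)
    (σ : Fin n ≃ (K →+* ℝ)) {a : Fin L → 𝓞 K} (ha : 0 < ‖moduleEmbedding σ Mbar a‖) :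
    (n : ℝ) / 2 * (Real.logb 2 n - 2 * Real.logb 2 ‖moduleEmbedding σ Mbar a‖)
      ≤ equationRate σ P h a := by
  have hn' : (0 : ℝ) < n := Nat.cast_pos.mpr hn0
  refine mul_le_mul_of_nonneg_left (le_trans (le_of_eq ?_) (logb_le_logPlus _)) (by positivity)
  rw [← hM.norm_sq, Real.logb_div hn'.ne' (by positivity), Real.logb_pow]
  norm_num

/-- The inclusion of `𝓞 K`-coefficient vectors in the `K`-coefficient vectors. -/
def coeVec (a : Fin L → 𝓞 K) (l : Fin L) : K := a l

theorem successiveMinimum_eq (σ : Fin n ≃ (K →+* ℝ)) (N : Fin n → Matrix (Fin L) (Fin L) ℝ)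
    (i : ℕ) : successiveMinimum σ N i
      = lengthMinimum K (coeVec (K := K)) (fun a => ‖moduleEmbedding σ N a‖) i := rfl

theorem span_range_coeVec :
    Submodule.span K (Set.range (coeVec : (Fin L → 𝓞 K) → Fin L → K)) = ⊤ := by
  rw [eq_top_iff, ← (Pi.basisFun K (Fin L)).span_eq]
  refine Submodule.span_mono ?_
  rintro _ ⟨l, rfl⟩
  refine ⟨Pi.single l 1, ?_⟩
  ext k
  rcases eq_or_ne k l with rfl | h <;> simp [coeVec, *]

/-! ### Discriminant, covolume and Hermite's inequality for the module -/

variable [NumberField K]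

/-- The ring homomorphism `K → ℂ` underlying a real embedding, as a bijection with all
complex embeddings when there are as many real embeddings as the degree. -/
theorem bijective_ofReal_comp (hn : Module.finrank ℚ K = n) (σ : Fin n ≃ (K →+* ℝ)) :
    Function.Bijective fun j => (Complex.ofRealHom.comp (σ j) : K →+* ℂ) := by
  rw [Fintype.bijective_iff_injective_and_card]
  refine ⟨fun i j hij => σ.injective (RingHom.ext fun x => ?_), ?_⟩
  · simpa using congrArg (fun f : K →+* ℂ => f x) hij
  · rw [Fintype.card_fin, NumberField.Embeddings.card, hn]

/-- The square of the determinant of the conjugates of an integral basis is the discriminant. -/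
theorem exists_integralBasis_det_sq (hn : Module.finrank ℚ K = n) (σ : Fin n ≃ (K →+* ℝ)) :
    ∃ ω : Fin n → 𝓞 K,
      (Matrix.of fun j k => σ j (ω k : K)).det ^ 2 = (NumberField.discr K : ℝ) := by
  have hcard : Fintype.card (Module.Free.ChooseBasisIndex ℤ (𝓞 K)) = Fintype.card (Fin n) := by
    rw [← Module.finrank_eq_card_chooseBasisIndex, NumberField.RingOfIntegers.rank, hn,
      Fintype.card_fin]
  let ε := Fintype.equivOfCardEq hcard
  -- The discriminant formula is applied to complex embeddings; these are exactly the `σ j` followed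
  -- by `ℝ → ℂ`, so the identity descends to `ℝ`.
  let e : Fin n ≃ (K →ₐ[ℚ] ℂ) :=
    (Equiv.ofBijective _ (bijective_ofReal_comp hn σ)).trans (RingHom.equivRatAlgHom K ℂ)
  refine ⟨fun k => NumberField.RingOfIntegers.basis K (ε.symm k), ?_⟩
  have h1 := Algebra.discr_eq_det_embeddingsMatrixReindex_pow_two ℚ ℂ
    (NumberField.integralBasis K ∘ ε.symm) e
  have h2 : Algebra.discr ℚ (NumberField.integralBasis K ∘ ε.symm) = NumberField.discr K := by
    rw [Algebra.discr_reindex, ← NumberField.coe_discr]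
  have h3 : Algebra.embeddingsMatrixReindex ℚ ℂ (NumberField.integralBasis K ∘ ε.symm) e
      = Complex.ofRealHom.mapMatrix (Matrix.of fun j k =>
        σ j (NumberField.RingOfIntegers.basis K (ε.symm k) : K))ᵀ := by
    ext j k
    simp [Algebra.embeddingsMatrixReindex, Algebra.embeddingsMatrix, e,
      NumberField.integralBasis_apply]
  rw [h2, h3, ← RingHom.map_det, Matrix.det_transpose] at h1
  apply Complex.ofReal_injective
  simpa using h1.symm

/-- Hermite's inequality for the lattice of the `𝓞 K`-module generated by the tuple `N`. -/
theorem sq_le_hermiteConstant_mul_discr (hn : Module.finrank ℚ K = n) (hL : 0 < L)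
    (σ : Fin n ≃ (K →+* ℝ)) (N : Fin n → Matrix (Fin L) (Fin L) ℝ) (hN : ∀ j, (N j).det ≠ 0)
    {c : ℝ} (hc : 0 ≤ c) (h : ∀ a : Fin L → 𝓞 K, a ≠ 0 → c ≤ ‖moduleEmbedding σ N a‖) :
    c ^ 2 ≤ hermiteConstant (n * L) * (|(NumberField.discr K : ℝ)| ^ (1 / (n : ℝ))
      * (∏ j, |(N j).det|) ^ (2 / ((n : ℝ) * L))) := by
  have hn0 : 0 < n := hn ▸ Module.finrank_pos
  obtain ⟨ω, hω⟩ := exists_integralBasis_det_sq hn σ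
  set Ω : Matrix (Fin n) (Fin n) ℝ := Matrix.of fun j k => σ j (ω k : K) with hΩ
  have hΩ0 : Ω.det ≠ 0 := fun h0 => NumberField.discr_ne_zero K (by
    rw [h0, zero_pow two_ne_zero] at hω; exact_mod_cast hω.symm)
  -- The columns of `D` are the embeddings of `ω k` times the `l`-th unit vector. The swap is needed
  -- because `blockDiagonal` puts the block index second.
  let D : Matrix (Fin n × Fin L) (Fin n × Fin L) ℝ :=
    Matrix.reindex (Equiv.prodComm _ _) (Equiv.prodComm _ _) (Matrix.blockDiagonal N)
      * Matrix.kronecker Ω (1 : Matrix (Fin L) (Fin L) ℝ)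
  have hDdet : D.det = (∏ j, (N j).det) * Ω.det ^ L := by
    rw [Matrix.det_mul, Matrix.det_reindex_self, Matrix.det_blockDiagonal, Matrix.kronecker,
      Matrix.det_kronecker]
    simp
  have hDcol (k : Fin n) (l : Fin L) :
      (fun p => D p (k, l)) = moduleEmbedding σ N (Pi.single l (ω k)) := by
    ext ⟨j, i⟩
    simp only [D, Matrix.mul_apply, moduleEmbedding, Matrix.mulVec, dotProduct, conj,
      Fintype.sum_prod_type, Matrix.reindex_apply, Matrix.submatrix_apply, Equiv.prodComm_symm,
      Equiv.prodComm_apply, Prod.swap_prod_mk, Matrix.blockDiagonal_apply, Matrix.kronecker,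
      Matrix.kroneckerMap_apply, Matrix.one_apply]
    rw [Finset.sum_eq_single j (by intro b _ hb; simp [Ne.symm hb]) (by simp)]
    refine Finset.sum_congr rfl fun x _ => ?_
    rcases eq_or_ne x l with rfl | hx
    · simp [hΩ]
    · simp [hx]
  let e : Fin n × Fin L ≃ Fin (n * L) := finProdFinEquiv
  let D' := Matrix.reindex e e D
  have hD'det : D'.det = (∏ j, (N j).det) * Ω.det ^ L := by rw [Matrix.det_reindex_self, hDdet]
  have hD'0 : D'.det ≠ 0 := by
    rw [hD'det]
    exact mul_ne_zero (Finset.prod_ne_zero_iff.mpr fun j _ => hN j) (pow_ne_zero _ hΩ0)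
  -- Only this inclusion is needed: the hypothesis already bounds the length of every nonzero module
  -- element.
  have hmem : ∀ x ∈ latticeOf D', ∃ a : Fin L → 𝓞 K,
      x = WithLp.toLp 2 fun q => moduleEmbedding σ N a (e.symm q) := by
    intro x hx
    induction hx using Submodule.span_induction with
    | mem x hx =>
      obtain ⟨q, rfl⟩ := hx
      refine ⟨Pi.single (e.symm q).2 (ω (e.symm q).1), ?_⟩
      ext i
      simpa [D'] using congrFun (hDcol (e.symm q).1 (e.symm q).2) (e.symm i)
    | zero => exact ⟨0, by ext i; simp [moduleEmbedding_zero]⟩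
    | add x y _ _ hx hy =>
      obtain ⟨a, rfl⟩ := hx
      obtain ⟨b, rfl⟩ := hy
      exact ⟨a + b, by ext i; simp [moduleEmbedding_add]⟩
    | smul z x _ hx =>
      obtain ⟨a, rfl⟩ := hx
      exact ⟨z • a, by ext i; simp only [moduleEmbedding_zsmul]; simp⟩
  have key := sq_le_hermiteConstant_mul (Nat.mul_pos hn0 hL) D' hD'0 hc ?_
  -- The exponent turns `|det Ω|^L` into `(det Ω ^ 2)^(1/n)`, the root discriminant.
  · have hd : |D'.det| ^ (2 / ((n * L : ℕ) : ℝ)) = |(NumberField.discr K : ℝ)| ^ (1 / (n : ℝ))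
        * (∏ j, |(N j).det|) ^ (2 / ((n : ℝ) * L)) := by
      rw [hD'det, abs_mul, Finset.abs_prod, Real.mul_rpow (by positivity) (by positivity), mul_comm,
        ← hω, abs_pow, abs_pow, ← Real.rpow_natCast, ← Real.rpow_natCast,
        ← Real.rpow_mul (abs_nonneg _), ← Real.rpow_mul (abs_nonneg _)]
      have : (L : ℝ) ≠ 0 := by positivity
      have : (n : ℝ) ≠ 0 := by positivity
      congr 2
      · push_cast
        field_simp
      · push_cast
        rfl
    rwa [hd] at key
  · intro x hx hx0
    obtain ⟨a, rfl⟩ := hmem x hx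
    have ha : a ≠ 0 := by
      rintro rfl
      exact hx0 (by ext i; simp [moduleEmbedding_zero])
    refine (h a ha).trans_eq ?_
    rw [EuclideanSpace.norm_eq, EuclideanSpace.norm_eq]
    congr 1
    exact (Equiv.sum_comp e.symm fun p => ‖moduleEmbedding σ N a p‖ ^ 2).symm

/-! ### Determinants of the channel matrices -/

/-- By `det (1 - u vᵀ) = 1 - vᵀ u`, the determinant is `1 - P‖h‖²/(P‖h‖² + 1)`. -/
theorem det_channelMatrix {P : ℝ} (hP : 0 < P) (h : EuclideanSpace ℝ (Fin L)) :
    (channelMatrix P h).det = (1 + P * ‖h‖ ^ 2)⁻¹ := by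
  have hq : 0 < P * ‖h‖ ^ 2 + 1 := by positivity
  rw [channelMatrix, ← Matrix.smul_vecMulVec, Matrix.vecMulVec_eq Unit,
    Matrix.det_one_sub_mul_comm]
  simp only [Matrix.det_unique, Matrix.sub_apply, Matrix.one_apply_eq,
    Matrix.replicateRow_mul_replicateCol_apply, dotProduct_smul, dotProduct_self_eq_norm_sq,
    smul_eq_mul]
  field_simp
  ring

theorem IsGenerator.abs_det_sq {P : ℝ} (hP : 0 < P) {h : Fin n → EuclideanSpace ℝ (Fin L)}
    {Mbar : Fin n → Matrix (Fin L) (Fin L) ℝ} (hM : IsGenerator P h Mbar) (j : Fin n) :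
    |(Mbar j).det| ^ 2 = (1 + P * ‖h j‖ ^ 2)⁻¹ := by
  rw [sq_abs, ← det_channelMatrix hP, ← hM j, Matrix.det_mul, Matrix.det_transpose, sq]

theorem IsGenerator.det_ne_zero {P : ℝ} (hP : 0 < P) {h : Fin n → EuclideanSpace ℝ (Fin L)}
    {Mbar : Fin n → Matrix (Fin L) (Fin L) ℝ} (hM : IsGenerator P h Mbar) (j : Fin n) :
    (Mbar j).det ≠ 0 := by
  intro h0
  have := hM.abs_det_sq hP j
  rw [h0] at this
  have hpos : 0 < (1 + P * ‖h j‖ ^ 2)⁻¹ := by positivity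
  rw [← this] at hpos
  simp at hpos

/-! ### Existence of minimal vectors and the flag they span -/

/-- Only finitely many coefficient vectors have embedded length below a given bound. -/
theorem finite_norm_moduleEmbedding_le (hn : Module.finrank ℚ K = n) (σ : Fin n ≃ (K →+* ℝ))
    {N : Fin n → Matrix (Fin L) (Fin L) ℝ} (hN : ∀ j, (N j).det ≠ 0) (r : ℝ) :
    {a : Fin L → 𝓞 K | ‖moduleEmbedding σ N a‖ ≤ r}.Finite := by
  -- Inverting `N j` bounds every conjugate of every entry. Summing over all `j` and `l` makes the
  -- bound uniform, and only finitely many algebraic integers of `K` have all conjugates bounded by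
  -- `C`.
  let C : ℝ := ∑ j, ∑ l, ∑ i, |(N j)⁻¹ l i| * r
  have hbound : ∀ a : Fin L → 𝓞 K, ‖moduleEmbedding σ N a‖ ≤ r → ∀ j l,
      |σ j (a l : K)| ≤ C := by
    intro a ha j l
    have hr : 0 ≤ r := (norm_nonneg _).trans ha
    have h1 : conj σ j a = (N j)⁻¹ *ᵥ (N j *ᵥ conj σ j a) := by
      rw [Matrix.mulVec_mulVec, Matrix.nonsing_inv_mul _ (isUnit_iff_ne_zero.mpr (hN j)),
        Matrix.one_mulVec]
    have h2 : σ j (a l : K) = ∑ i, (N j)⁻¹ l i * (N j *ᵥ conj σ j a) i := congrFun h1 l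
    have h3 : ∀ i, |(N j *ᵥ conj σ j a) i| ≤ r := fun i =>
      (PiLp.norm_apply_le (moduleEmbedding σ N a) (j, i)).trans ha
    have hnn : ∀ j l, 0 ≤ ∑ i, |(N j)⁻¹ l i| * r := fun j l =>
      Finset.sum_nonneg fun i _ => by positivity
    calc |σ j (a l : K)| ≤ ∑ i, |(N j)⁻¹ l i| * r := by
          rw [h2]
          refine (Finset.abs_sum_le_sum_abs _ _).trans (Finset.sum_le_sum fun i _ => ?_)
          rw [abs_mul]
          exact mul_le_mul_of_nonneg_left (h3 i) (abs_nonneg _)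
      _ ≤ ∑ l, ∑ i, |(N j)⁻¹ l i| * r :=
          Finset.single_le_sum (f := fun l => ∑ i, |(N j)⁻¹ l i| * r)
            (fun l _ => hnn j l) (Finset.mem_univ l)
      _ ≤ C := Finset.single_le_sum (f := fun j => ∑ l, ∑ i, |(N j)⁻¹ l i| * r)
            (fun j _ => Finset.sum_nonneg fun l _ => hnn j l) (Finset.mem_univ j)
  have hfin := NumberField.Embeddings.finite_of_norm_le K ℂ C
  have hfin' : {x : 𝓞 K | ∀ φ : K →+* ℂ, ‖φ x‖ ≤ C}.Finite := by
    refine Set.Finite.of_finite_image (f := fun x : 𝓞 K => (x : K)) (hfin.subset ?_)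
      (fun x _ y _ hxy => NumberField.RingOfIntegers.ext hxy)
    rintro _ ⟨x, hx, rfl⟩
    exact ⟨NumberField.RingOfIntegers.isIntegral_coe x, hx⟩
  refine (Set.Finite.pi fun _ : Fin L => hfin').subset fun a ha l _ φ => ?_
  obtain ⟨j, rfl⟩ := (bijective_ofReal_comp hn σ).2 φ
  simpa using hbound a ha j l

theorem linearIndependent_coeVec {k : Type*} {a : k → Fin L → 𝓞 K} :
    LinearIndependent K (coeVec ∘ a) ↔ LinearIndependent (𝓞 K) a := by
  rw [← LinearIndependent.iff_fractionRing (𝓞 K) K]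
  let φ : (Fin L → 𝓞 K) →ₗ[𝓞 K] (Fin L → K) :=
    LinearMap.pi fun l => (Algebra.linearMap (𝓞 K) K).comp (LinearMap.proj l)
  refine φ.linearIndependent_iff (LinearMap.ker_eq_bot.mpr fun a b hab => ?_)
  ext l
  exact congrFun hab l

theorem exists_achievesMinima (hn : Module.finrank ℚ K = n) (σ : Fin n ≃ (K →+* ℝ))
    {N : Fin n → Matrix (Fin L) (Fin L) ℝ} (hN : ∀ j, (N j).det ≠ 0) :
    ∃ a : Fin L → Fin L → 𝓞 K, AchievesMinima σ N a := by
  obtain ⟨a, ha, hmin⟩ := exists_achieves_lengthMinimum (F := K) (ι := coeVec (K := K))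
    (ν := fun a => ‖moduleEmbedding σ N a‖) (fun _ => norm_nonneg _)
    (finite_norm_moduleEmbedding_le hn σ hN) span_range_coeVec (Module.finrank_fin_fun K)
  exact ⟨a, linearIndependent_coeVec.mp ha, hmin⟩

theorem AchievesMinima.mem_span {σ : Fin n ≃ (K →+* ℝ)} {N : Fin n → Matrix (Fin L) (Fin L) ℝ}
    {a : Fin L → Fin L → 𝓞 K} (ha : AchievesMinima σ N a) (i : Fin L) {x : Fin L → 𝓞 K}
    (hx : ‖moduleEmbedding σ N x‖ < ‖moduleEmbedding σ N (a i)‖) :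
    coeVec x ∈ Submodule.span K ((coeVec ∘ a) '' Set.Iio i) := by
  have hle : ∀ k : Fin L, ‖moduleEmbedding σ N (a k)‖
      ≤ lengthMinimum K (coeVec (K := K)) (fun a => ‖moduleEmbedding σ N a‖) (k + 1) := fun k => by
    rw [← successiveMinimum_eq]
    exact (ha.2 k).le
  refine mem_span_of_lt_lengthMinimum (F := K) (ι := coeVec (K := K))
    (ν := fun a => ‖moduleEmbedding σ N a‖) (fun _ => norm_nonneg _)
    (linearIndependent_coeVec.mpr ha.1) hle i ?_
  rw [← successiveMinimum_eq, ← ha.2 i]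
  exact hx

/-- If `a i` were shorter than `a k`, it would lie in the span of the vectors before `a k`, against
independence. -/
theorem AchievesMinima.norm_mono {σ : Fin n ≃ (K →+* ℝ)} {N : Fin n → Matrix (Fin L) (Fin L) ℝ}
    {a : Fin L → Fin L → 𝓞 K} (ha : AchievesMinima σ N a) {k i : Fin L} (hki : k ≤ i) :
    ‖moduleEmbedding σ N (a k)‖ ≤ ‖moduleEmbedding σ N (a i)‖ := by
  by_contra! hlt
  exact (linearIndependent_coeVec.mpr ha.1).notMem_span_image (s := Set.Iio k) (x := i)
    (fun h => (lt_irrefl _ (hki.trans_lt h))) (ha.mem_span k hlt)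

/-- A nonzero vector lies in the span of the first vectors achieving minima, up to the last
one that is not longer than itself. -/
theorem AchievesMinima.exists_mem_span {σ : Fin n ≃ (K →+* ℝ)}
    {N : Fin n → Matrix (Fin L) (Fin L) ℝ} {a : Fin L → Fin L → 𝓞 K} (ha : AchievesMinima σ N a)
    {x : Fin L → 𝓞 K} (hx : x ≠ 0) :
    ∃ i : Fin L, coeVec x ∈ Submodule.span K ((coeVec ∘ a) '' Set.Iic i) ∧
      ‖moduleEmbedding σ N (a i)‖ ≤ ‖moduleEmbedding σ N x‖ := by
  classical
  -- Take the least `k` with `x` in the span `W k` of the first `k` vectors; `k ≠ 0` since `x ≠ 0`.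
  -- Were `x` shorter than the vector of index `k - 1`, it would already lie in `W (k - 1)`.
  let W : ℕ → Submodule K (Fin L → K) := fun k =>
    Submodule.span K ((coeVec ∘ a) '' {i : Fin L | (i : ℕ) < k})
  have hWL : coeVec x ∈ W L := by
    have huniv : {i : Fin L | (i : ℕ) < L} = Set.univ := Set.eq_univ_of_forall fun i => i.2
    simp only [W, huniv, Set.image_univ]
    rw [(linearIndependent_coeVec.mpr ha.1).span_eq_top_of_card_eq_finrank' (by simp)]
    trivial
  have hex : ∃ k, coeVec x ∈ W k := ⟨L, hWL⟩
  have hspec := Nat.find_spec hex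
  have hmin := fun m => Nat.find_min (m := m) hex
  have hle := Nat.find_min' hex hWL
  generalize Nat.find hex = k at hspec hmin hle
  obtain _ | i := k
  · refine (hx ?_).elim
    have h0 : coeVec x = 0 := by simpa [W] using hspec
    ext l
    exact congrFun h0 l
  · refine ⟨⟨i, hle⟩, Submodule.span_mono (Set.image_mono fun m hm => ?_) hspec, ?_⟩
    · exact Fin.le_def.mpr (Nat.lt_succ_iff.mp hm)
    · by_contra! hlt
      exact hmin i (Nat.lt_succ_self i) (ha.mem_span ⟨i, hle⟩ hlt)

/-! ### Minkowski's second theorem over `𝓞 K` by distorting the lattice -/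

/-- A linear functional on `ℝ^L` vanishing on the conjugates of vectors vanishes on the
conjugates of every vector of their `K`-span. -/
theorem map_conj_eq_zero_of_mem_span (σ : Fin n ≃ (K →+* ℝ)) (j : Fin n)
    (φ : (Fin L → ℝ) →ₗ[ℝ] ℝ) {s : Set (Fin L → K)} (hs : ∀ y ∈ s, φ (fun l => σ j (y l)) = 0)
    {x : Fin L → K} (hx : x ∈ Submodule.span K s) : φ (fun l => σ j (x l)) = 0 := by
  induction hx using Submodule.span_induction with
  | mem y hy => exact hs y hy
  | zero =>
    have : (fun l => σ j ((0 : Fin L → K) l)) = 0 := by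
      ext l; simp
    rw [this, map_zero]
  | add y z _ _ hy hz =>
    have : (fun l => σ j ((y + z) l)) = (fun l => σ j (y l)) + fun l => σ j (z l) := by
      ext l; simp
    rw [this, map_add, hy, hz, add_zero]
  | smul c y _ hy =>
    have : (fun l => σ j ((c • y) l)) = σ j c • fun l => σ j (y l) := by
      ext l; simp
    rw [this, map_smul, hy, smul_zero]

/-- The matrix of coordinates with respect to an orthonormal basis. -/
noncomputable def coordMatrix (b : OrthonormalBasis (Fin L) ℝ (EuclideanSpace ℝ (Fin L))) :
    Matrix (Fin L) (Fin L) ℝ :=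
  Matrix.of fun i l => b i l

theorem coordMatrix_mulVec (b : OrthonormalBasis (Fin L) ℝ (EuclideanSpace ℝ (Fin L)))
    (v : Fin L → ℝ) (i : Fin L) : (coordMatrix b *ᵥ v) i = inner ℝ (b i) (WithLp.toLp 2 v) := by
  simp [coordMatrix, Matrix.mulVec, dotProduct, PiLp.inner_apply, mul_comm]

theorem abs_det_coordMatrix (b : OrthonormalBasis (Fin L) ℝ (EuclideanSpace ℝ (Fin L))) :
    |(coordMatrix b).det| = 1 := by
  have h1 : coordMatrix b * (coordMatrix b)ᵀ = 1 := by
    ext i k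
    have := orthonormal_iff_ite.mp b.orthonormal i k
    rw [Matrix.one_apply, ← this]
    simp [coordMatrix, Matrix.mul_apply, PiLp.inner_apply, mul_comm]
  have h2 := congrArg Matrix.det h1
  rw [Matrix.det_mul, Matrix.det_transpose, Matrix.det_one] at h2
  rw [← sq, ← sq_abs] at h2
  exact (pow_eq_one_iff_of_nonneg (abs_nonneg _) two_ne_zero).mp h2

/-- Minkowski's second theorem for the successive minima over `𝓞 K`. -/
theorem AchievesMinima.one_le_hermiteConstant_mul (hn : Module.finrank ℚ K = n) (hL : 0 < L)
    {σ : Fin n ≃ (K →+* ℝ)} {N : Fin n → Matrix (Fin L) (Fin L) ℝ} (hN : ∀ j, (N j).det ≠ 0)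
    {a : Fin L → Fin L → 𝓞 K} (ha : AchievesMinima σ N a) :
    1 ≤ hermiteConstant (n * L) * (|(NumberField.discr K : ℝ)| ^ (1 / (n : ℝ))
      * (∏ j, ((∏ i, ‖moduleEmbedding σ N (a i)‖)⁻¹ * |(N j).det|)) ^ (2 / ((n : ℝ) * L))) := by
  have hn0 : 0 < n := hn ▸ Module.finrank_pos
  set lam : Fin L → ℝ := fun i => ‖moduleEmbedding σ N (a i)‖ with hlam
  have hlam0 : ∀ i, 0 < lam i := fun i =>
    norm_pos_iff.mpr (moduleEmbedding_ne_zero hn0 σ hN (ha.1.ne_zero i))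
  let f : Fin n → Fin L → EuclideanSpace ℝ (Fin L) := fun j i =>
    WithLp.toLp 2 (N j *ᵥ conj σ j (a i))
  let b : Fin n → OrthonormalBasis (Fin L) ℝ (EuclideanSpace ℝ (Fin L)) := fun j =>
    InnerProductSpace.gramSchmidtOrthonormalBasis (by simp) (f j)
  -- The same scalings `1/λᵢ` serve all `n` blocks; the rotation leaves the absolute determinant
  -- unchanged.
  let N' : Fin n → Matrix (Fin L) (Fin L) ℝ := fun j =>
    Matrix.diagonal (fun i => (lam i)⁻¹) * (coordMatrix (b j) * N j)
  have hN' : ∀ j, |(N' j).det| = (∏ i, lam i)⁻¹ * |(N j).det| := fun j => by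
    have hpos : 0 < (∏ i, lam i)⁻¹ := inv_pos.mpr (Finset.prod_pos fun i _ => hlam0 i)
    rw [Matrix.det_mul, Matrix.det_mul, Matrix.det_diagonal, abs_mul, abs_mul,
      abs_det_coordMatrix, one_mul, Finset.prod_inv_distrib, abs_of_pos hpos]
  have hN'0 : ∀ j, (N' j).det ≠ 0 := fun j => by
    rw [← abs_pos, hN' j]
    exact mul_pos (inv_pos.mpr (Finset.prod_pos fun i _ => hlam0 i)) (abs_pos.mpr (hN j))
  have hN'v : ∀ j (v : Fin L → ℝ) i,
      (N' j *ᵥ v) i = (lam i)⁻¹ * inner ℝ (b j i) (WithLp.toLp 2 (N j *ᵥ v)) := fun j v i => by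
    rw [← Matrix.mulVec_mulVec, Matrix.mulVec_diagonal, ← Matrix.mulVec_mulVec, coordMatrix_mulVec]
  have key := sq_le_hermiteConstant_mul_discr hn hL σ N' hN'0 zero_le_one ?_
  · simpa only [one_pow, hN'] using key
  intro x hx
  obtain ⟨i, hmem, hle⟩ := ha.exists_mem_span hx
  -- Gram–Schmidt makes the `m`-th coordinate vanish on the images of `a k` for `k < m`. It is a
  -- real functional, so its vanishing passes to conjugates of the whole `K`-span.
  have hzero : ∀ j m, i < m → inner ℝ (b j m) (WithLp.toLp 2 (N j *ᵥ conj σ j x)) = 0 := by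
    intro j m hm
    let φ : (Fin L → ℝ) →ₗ[ℝ] ℝ :=
      (LinearMap.proj m).comp (Matrix.mulVecLin (coordMatrix (b j) * N j))
    have hφ : ∀ v, φ v = inner ℝ (b j m) (WithLp.toLp 2 (N j *ᵥ v)) := fun v => by
      simp only [φ, LinearMap.comp_apply, Matrix.mulVecLin_apply, LinearMap.proj_apply]
      rw [← Matrix.mulVec_mulVec, coordMatrix_mulVec]
    have h0 := map_conj_eq_zero_of_mem_span σ j φ ?_ hmem
    · rwa [hφ] at h0
    · rintro _ ⟨k, hk, rfl⟩
      rw [hφ]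
      exact InnerProductSpace.gramSchmidtOrthonormalBasis_inv_triangular _ (f j)
        (lt_of_le_of_lt hk hm)
  -- Only coordinates `m ≤ i` survive, and there `1/λₘ ≥ 1/λᵢ`.
  have hsq : (lam i)⁻¹ ^ 2 * ‖moduleEmbedding σ N x‖ ^ 2 ≤ ‖moduleEmbedding σ N' x‖ ^ 2 := by
    rw [norm_moduleEmbedding_sq, norm_moduleEmbedding_sq, Finset.mul_sum]
    refine Finset.sum_le_sum fun j _ => ?_
    rw [← (b j).sum_sq_norm_inner_right, EuclideanSpace.real_norm_sq_eq, Finset.mul_sum]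
    refine Finset.sum_le_sum fun m _ => ?_
    simp only [hN'v, mul_pow, Real.norm_eq_abs, sq_abs]
    rcases le_or_gt m i with hmi | him
    · have hmono : lam m ≤ lam i := ha.norm_mono hmi
      have hpos := hlam0 m
      gcongr
    · rw [hzero j m him]
      simp
  have h1 : 1 ≤ (lam i)⁻¹ ^ 2 * ‖moduleEmbedding σ N x‖ ^ 2 := by
    rw [← mul_pow]
    refine one_le_pow₀ ?_
    rw [inv_mul_eq_div, one_le_div (hlam0 i)]
    exact hle
  exact (one_le_sq_iff₀ (norm_nonneg _)).mp (h1.trans hsq)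

/-! ### Passage to logarithms -/

theorem logPlus_one_add {x : ℝ} (hx : 0 ≤ x) : logPlus (1 + x) = Real.logb 2 (1 + x) :=
  max_eq_left (Real.logb_nonneg one_lt_two (by linarith))

theorem IsGenerator.logb_prod_abs_det {P : ℝ} (hP : 0 < P)
    {h : Fin n → EuclideanSpace ℝ (Fin L)} {Mbar : Fin n → Matrix (Fin L) (Fin L) ℝ}
    (hM : IsGenerator P h Mbar) :
    Real.logb 2 (∏ j, |(Mbar j).det|) = -(1 / 2) * ∑ j, logPlus (1 + P * ‖h j‖ ^ 2) := by
  rw [Real.logb_prod _ _ fun j _ => abs_ne_zero.mpr (hM.det_ne_zero hP j), Finset.mul_sum]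
  refine Finset.sum_congr rfl fun j _ => ?_
  have h1 := congrArg (Real.logb 2) (hM.abs_det_sq hP j)
  rw [Real.logb_pow, Real.logb_inv] at h1
  rw [logPlus_one_add (by positivity)]
  push_cast at h1
  linarith

/-- Taking logarithms in a bound by Hermite's constant. -/
theorem logb_le_of_le_mul {c κ d D e : ℝ} (hc : 0 < c) (hd : 0 < d) (hD : 0 < D)
    (h : c ≤ κ * (d * D ^ e)) :
    0 < κ ∧ Real.logb 2 c ≤ Real.logb 2 κ + Real.logb 2 d + e * Real.logb 2 D := by
  have hDe : 0 < D ^ e := Real.rpow_pos_of_pos hD e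
  -- Positivity of Hermite's constant is read off from the inequality itself.
  have hκ : 0 < κ := pos_of_mul_pos_left (hc.trans_le h) (by positivity)
  refine ⟨hκ, ?_⟩
  rw [add_assoc, ← Real.logb_rpow_eq_mul_logb_of_pos hD, ← Real.logb_mul hd.ne' hDe.ne',
    ← Real.logb_mul hκ.ne' (by positivity)]
  exact Real.logb_le_logb_of_le one_lt_two hc h

theorem logPlus_hermite_ge {κ d : ℝ} (hn0 : 0 < n) (hκ : 0 < κ) (hd : 0 < d) :
    Real.logb 2 κ + Real.logb 2 d - Real.logb 2 n ≤ logPlus (κ / n * d) := by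
  refine le_trans (le_of_eq ?_) (logb_le_logPlus _)
  have hn' : (0 : ℝ) < n := Nat.cast_pos.mpr hn0
  rw [Real.logb_mul (by positivity) hd.ne', Real.logb_div hκ.ne' hn'.ne']
  ring

end RingCF

/-! ### The two rate bounds -/

theorem mainTheorem4 {K : Type*} [Field K] [NumberField K] [NumberField.IsTotallyReal K]
    (n L : ℕ) (hn : Module.finrank ℚ K = n) (hL : 0 < L)
    (σ : Fin n ≃ (K →+* ℝ)) (P : ℝ) (hP : 0 < P)
    (h : Fin n → EuclideanSpace ℝ (Fin L))
    (Mbar : Fin n → Matrix (Fin L) (Fin L) ℝ) (hM : RingCF.IsGenerator P h Mbar) :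
    (∃ a : Fin L → Fin L → NumberField.RingOfIntegers K, RingCF.AchievesMinima σ Mbar a) ∧
    ∀ a : Fin L → Fin L → NumberField.RingOfIntegers K, RingCF.AchievesMinima σ Mbar a →
      (1 / (2 * (L : ℝ)) * (∑ j, RingCF.logPlus (1 + P * ‖h j‖ ^ 2))
          - (n : ℝ) / 2 * RingCF.logPlus (RingCF.hermiteConstant (n * L) / (n : ℝ)
              * |(NumberField.discr K : ℝ)| ^ (1 / (n : ℝ)))
        ≤ RingCF.equationRate σ P h (a ⟨0, hL⟩)) ∧
      (1 / 2 * (∑ j, RingCF.logPlus (1 + P * ‖h j‖ ^ 2))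
          - (n : ℝ) * (L : ℝ) / 2 * RingCF.logPlus (RingCF.hermiteConstant (n * L) / (n : ℝ)
              * |(NumberField.discr K : ℝ)| ^ (1 / (n : ℝ)))
        ≤ ∑ i, RingCF.equationRate σ P h (a i)) := by
  have hn0 : 0 < n := hn ▸ Module.finrank_pos
  have hn' : (0 : ℝ) < n := Nat.cast_pos.mpr hn0
  have hL' : (0 : ℝ) < L := Nat.cast_pos.mpr hL
  have hdet := fun j => hM.det_ne_zero hP j
  refine ⟨RingCF.exists_achievesMinima hn σ hdet, fun a ha => ?_⟩
  have hpos : ∀ i, 0 < ‖RingCF.moduleEmbedding σ Mbar (a i)‖ := fun i =>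
    norm_pos_iff.mpr (RingCF.moduleEmbedding_ne_zero hn0 σ hdet (ha.1.ne_zero i))
  have hprod : 0 < ∏ i, ‖RingCF.moduleEmbedding σ Mbar (a i)‖ :=
    Finset.prod_pos fun i _ => hpos i
  have hdetprod : 0 < ∏ j, |(Mbar j).det| := Finset.prod_pos fun j _ => abs_pos.mpr (hdet j)
  have hd : 0 < |(NumberField.discr K : ℝ)| ^ (1 / (n : ℝ)) :=
    Real.rpow_pos_of_pos (abs_pos.mpr (Int.cast_ne_zero.mpr (NumberField.discr_ne_zero K))) _
  have hS := hM.logb_prod_abs_det hP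
  set S := ∑ j, RingCF.logPlus (1 + P * ‖h j‖ ^ 2) with hSdef
  constructor
  -- The first minimal vector is a shortest nonzero vector of the whole module, so Hermite's
  -- inequality applies with its length.
  · have hmin : ∀ x : Fin L → NumberField.RingOfIntegers K, x ≠ 0 →
        ‖RingCF.moduleEmbedding σ Mbar (a ⟨0, hL⟩)‖ ≤ ‖RingCF.moduleEmbedding σ Mbar x‖ := by
      intro x hx
      obtain ⟨i, -, hi⟩ := ha.exists_mem_span hx
      exact (ha.norm_mono (Fin.le_def.mpr (Nat.zero_le _))).trans hi
    have h0 := hpos ⟨0, hL⟩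
    obtain ⟨hκ, hlog⟩ := RingCF.logb_le_of_le_mul (pow_pos h0 2) hd hdetprod
      (RingCF.sq_le_hermiteConstant_mul_discr hn hL σ Mbar hdet h0.le hmin)
    rw [Real.logb_pow, hS] at hlog
    have hH := RingCF.logPlus_hermite_ge hn0 hκ hd
    refine le_trans ?_ (hM.le_equationRate hn0 σ h0)
    have hS' : 1 / (2 * (L : ℝ)) * S = (n : ℝ) / 2 * (2 / ((n : ℝ) * L) * (1 / 2 * S)) := by
      field_simp
    rw [hS', ← mul_sub]
    refine mul_le_mul_of_nonneg_left ?_ (by positivity)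
    push_cast at hlog
    linarith
  · have hfac : ∏ j, ((∏ i, ‖RingCF.moduleEmbedding σ Mbar (a i)‖)⁻¹ * |(Mbar j).det|)
        = (∏ i, ‖RingCF.moduleEmbedding σ Mbar (a i)‖)⁻¹ ^ n * ∏ j, |(Mbar j).det| := by
      rw [Finset.prod_mul_distrib, Finset.prod_const, Finset.card_univ, Fintype.card_fin]
    have hbound := ha.one_le_hermiteConstant_mul hn hL hdet
    rw [hfac] at hbound
    obtain ⟨hκ, hlog⟩ := RingCF.logb_le_of_le_mul one_pos hd (by positivity) hbound
    rw [Real.logb_mul (by positivity) hdetprod.ne', hS, Real.logb_pow, Real.logb_inv,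
      Real.logb_prod _ _ fun i _ => (hpos i).ne', Real.logb_one] at hlog
    have hH := RingCF.logPlus_hermite_ge hn0 hκ hd
    refine le_trans ?_ (Finset.sum_le_sum fun i _ => hM.le_equationRate hn0 σ (hpos i))
    rw [← Finset.mul_sum, Finset.sum_sub_distrib, ← Finset.mul_sum, Finset.sum_const,
      Finset.card_univ, Fintype.card_fin, nsmul_eq_mul]
    set T := ∑ i, Real.logb 2 ‖RingCF.moduleEmbedding σ Mbar (a i)‖ with hT
    -- The factor `nL/2` cancels the exponent `2/(nL)`, leaving `-n ∑ log λᵢ - S/2`.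
    have hscaled := mul_le_mul_of_nonneg_left (hlog.trans (add_le_add_left
      (sub_le_iff_le_add.mp hH) _)) (show 0 ≤ (n : ℝ) * L / 2 by positivity)
    have hexp : (n : ℝ) * L / 2 * (2 / ((n : ℝ) * L) * (n * -T + -(1 / 2) * S))
        = n * -T + -(1 / 2) * S := by
      field_simp
    rw [mul_add _ (_ + _), hexp] at hscaled
    linarith
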